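/- Work over $\mathbb{C}$. Let $\Sigma_r=\mathbb{P}(\mathcal{O}_{\mathbb{P}^1}(r)\oplus\mathcal{O}_{\mathbb{P}^1})$ be the $r$-th Hirzebruch surface, with its section $E_r$ of self-intersection $-r$. The elementary transform $\Sigma_r\dashrightarrow\Sigma_{r+1}$ at a fibre $F$ is the birational map obtained by blowing up $\Sigma_r$ at the point $F\cap E_r$ and contracting the strict transform of $F$. For every integer $n\ge 2$ there is an irreducible curve $C\subset\Sigma_2$ with exactly one singular point $q$, such that the germ of $C$ at $q$ is analytically isomorphic to the germ at the origin of $\{x^n+y^n=0\}\subset\mathbb{C}^2$ (in particular, $q$ is an ordinary $n$-fold point of $C$). Moreover, $C$ can be obtained as follows from some smooth plane curve $C_2\subset\mathbb{P}^2$ of degree $n$ not passing through the point $a=[0:0:1]$: identify $\Sigma_1$ with the blow-up of $\mathbb{P}^2$ at $a$, in such a way that the fibres of $\Sigma_1\to\mathbb{P}^1$ are the strict transforms of the lines through $a$; let $C_1\subset\Sigma_1$ be the strict transform of $C_2$; choose a suitable fibre $F_0$ of $\Sigma_1$; take the strict transform $C'$ of $C_1$ in the blow-up of $\Sigma_1$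 at $F_0\cap E_1$; and let $C$ be the image of $C'$ in $\Sigma_2$ under the contraction of the strict transform of $F_0$. -/

import Mathlib

/-- Nonzero vectors of `ℂ²`, i.e. homogeneous coordinates on the complex projective line. -/
abbrev NonzeroPair : Type := {v : Fin 2 → ℂ // v ≠ 0}

/-- The equivalence relation on `(ℂ² ∖ 0) × (ℂ² ∖ 0)` whose quotient is `Σ_r`:
`(s; t₀, t₁) ∼ (l s; m lʳ t₀, m t₁)` for `l, m ∈ ℂˣ`. -/
def hirzebruchSetoid (r : ℕ) : Setoid (NonzeroPair × NonzeroPair) where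
  r p q := ∃ l m : ℂ, l ≠ 0 ∧ m ≠ 0 ∧ (∀ k, q.1.1 k = l * p.1.1 k) ∧
    q.2.1 0 = m * l ^ r * p.2.1 0 ∧ q.2.1 1 = m * p.2.1 1
  iseqv :=
    { refl := fun _ => ⟨1, 1, one_ne_zero, one_ne_zero, by simp, by simp, by simp⟩
      symm := by
        rintro p q ⟨l, m, hl, hm, h1, h2, h3⟩
        refine ⟨l⁻¹, m⁻¹, inv_ne_zero hl, inv_ne_zero hm, fun k => ?_, ?_, ?_⟩
        · rw [h1]; field_simp
        · rw [h2]
          have hr : l⁻¹ ^ r * l ^ r = 1 := by rw [← mul_pow, inv_mul_cancel₀ hl, one_pow]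
          linear_combination (-(m⁻¹ * m * p.2.1 0)) * hr - p.2.1 0 * inv_mul_cancel₀ hm
        · rw [h3]; field_simp
      trans := by
        rintro p q w ⟨l, m, hl, hm, h1, h2, h3⟩ ⟨l', m', hl', hm', h1', h2', h3'⟩
        refine ⟨l' * l, m' * m, mul_ne_zero hl' hl, mul_ne_zero hm' hm, fun k => ?_, ?_, ?_⟩
        · rw [h1', h1]; ring
        · rw [h2', h2]; ring
        · rw [h3', h3]; ring }

/-- The `r`-th Hirzebruch surface `Σ_r = ℙ(𝒪(r) ⊕ 𝒪)` over the complex projective line, as the set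
of its closed points.  The class of `(s; t₀, t₁)` is the line of `𝒪(r)_{[s]} ⊕ ℂ` spanned by
`(f, t₁)`, where the fibre `𝒪(r)_{[s]}` is the space of functions homogeneous of degree `r` on the
line `[s] ⊆ ℂ²`, and `f` is the one with `f s = t₀`.  The projection to the projective line is
`[s; t] ↦ [s]`, and the section `E_r` of self-intersection `-r` is `t₁ = 0`. -/
def Hirzebruch (r : ℕ) : Type := Quotient (hirzebruchSetoid r)

namespace Hirzebruch

/-- The point of `Σ_r` with homogeneous coordinates `(s; t)`. -/
def mk (r : ℕ) (s t : NonzeroPair) : Hirzebruch r :=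
  Quotient.mk (hirzebruchSetoid r) (s, t)

/-- Coordinates `(1, a)` (for `i = 0`) or `(a, 1)` (for `i = 1`). -/
def affinePair (i : Fin 2) (a : ℂ) : NonzeroPair :=
  ⟨fun k => if k = i then 1 else a, fun h => by simpa using congrFun h i⟩

/-- The four standard affine charts `ℂ² → Σ_r`; the image of chart `(i, j)` is the open set
`s_i ≠ 0, t_j ≠ 0`, on which the coordinates are normalised to `s_i = 1, t_j = 1`. -/
def chart (r : ℕ) (i j : Fin 2) (z : Fin 2 → ℂ) : Hirzebruch r :=
  mk r (affinePair i (z 0)) (affinePair j (z 1))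

/-- The Zariski topology on `ℂ²`: the closed sets are the common zero sets of polynomials. -/
@[reducible] noncomputable def planeZariski : TopologicalSpace (Fin 2 → ℂ) :=
  TopologicalSpace.induced
    (fun z => (MvPolynomial.pointToPoint z : PrimeSpectrum (MvPolynomial (Fin 2) ℂ)))
    inferInstance

/-- The Zariski topology on `Σ_r`: a set is closed iff it is Zariski closed in each chart. -/
noncomputable instance zariski (r : ℕ) : TopologicalSpace (Hirzebruch r) :=
  ⨆ i : Fin 2, ⨆ j : Fin 2, TopologicalSpace.coinduced (chart r i j) planeZariski

/-- `C ⊆ Σ_r` is a (reduced, possibly empty) curve: in each chart it is the zero set of one nonzero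
polynomial, i.e. it is the support of an effective divisor. -/
def IsCurve {r : ℕ} (C : Set (Hirzebruch r)) : Prop :=
  ∀ i j : Fin 2, ∃ f : MvPolynomial (Fin 2) ℂ, f ≠ 0 ∧
    ∀ z, chart r i j z ∈ C ↔ MvPolynomial.eval z f = 0

/-- `p` is a singular point of the (reduced) curve `C`: `p` lies on `C`, and in affine coordinates
at `p` the differential at `p` of every polynomial vanishing on `C` is zero. -/
def IsSingularPoint {r : ℕ} (C : Set (Hirzebruch r)) (p : Hirzebruch r) : Prop :=
  p ∈ C ∧ ∀ (i j : Fin 2) (z : Fin 2 → ℂ), chart r i j z = p →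
    ∀ f : MvPolynomial (Fin 2) ℂ, (∀ w, chart r i j w ∈ C → MvPolynomial.eval w f = 0) →
      ∀ k, MvPolynomial.eval z (MvPolynomial.pderiv k f) = 0

/-- The germ of `C` at `p` is analytically of type `g = 0` (for a square-free polynomial `g`): there
is a biholomorphic map `e` from a neighbourhood of `p` in `Σ_r` (in an affine chart) onto a
neighbourhood of `0` in `ℂ²`, taking `p` to `0` and `C` to the zero set of `g`.  The topology on
`Fin 2 → ℂ` here is the Euclidean one. -/
def HasAnalyticType {r : ℕ} (C : Set (Hirzebruch r)) (p : Hirzebruch r)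
    (g : MvPolynomial (Fin 2) ℂ) : Prop :=
  ∃ (i j : Fin 2) (z : Fin 2 → ℂ) (e : OpenPartialHomeomorph (Fin 2 → ℂ) (Fin 2 → ℂ)),
    chart r i j z = p ∧ z ∈ e.source ∧ e z = 0 ∧
    DifferentiableOn ℂ e e.source ∧ DifferentiableOn ℂ e.symm e.target ∧
    ∀ w ∈ e.source, (chart r i j w ∈ C ↔ MvPolynomial.eval (e w) g = 0)

/-- The blowing-up morphism `Σ_1 → ℙ²` of the point `a = [0 : 0 : 1]`,
`[s; t] ↦ [s₀ t₁ : s₁ t₁ : t₀]`.  Together with the projection `[s; t] ↦ [s]` it identifies `Σ_1`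
with the blow-up `{(P, [s]) | P₀ s₁ = P₁ s₀} ⊆ ℙ² × ℙ¹` of the plane at `a`; the exceptional
curve is the section `E_1 = {t₁ = 0}`, and the fibre over `[s]` is mapped onto the line
`P₀ s₁ = P₁ s₀` through `a`. -/
noncomputable def blowDown : Hirzebruch 1 → Projectivization ℂ (Fin 3 → ℂ) :=
  Quotient.lift
    (fun p : NonzeroPair × NonzeroPair =>
      Projectivization.mk ℂ ![p.1.1 0 * p.2.1 1, p.1.1 1 * p.2.1 1, p.2.1 0] (by
        intro h
        have h0 := congrFun h 0
        have h1 := congrFun h 1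
        have h2 := congrFun h 2
        simp at h0 h1 h2
        have ht : p.2.1 1 ≠ 0 := fun h3 => p.2.2 (by ext k; fin_cases k <;> simp [h2, h3])
        refine p.1.2 ?_
        ext k
        fin_cases k
        · simpa [ht] using h0
        · simpa [ht] using h1))
    (by
      rintro p q ⟨l, m, hl, hm, h1, h2, h3⟩
      refine ((Projectivization.mk_eq_mk_iff' ℂ _ _ _ _).2 ⟨l⁻¹ * m⁻¹, ?_⟩)
      ext k
      fin_cases k
      · simp [h1, h3]; field_simp
      · simp [h1, h3]; field_simp
      · simp [h2]; field_simp)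

/-- The surface `Σ_r' ⊆ Σ_r × Σ_{r+1}` through which the elementary transform
`Σ_r ⇢ Σ_{r+1}`, `[s; t₀, t₁] ↦ [s; ℓ(s) t₀, t₁]`, at the fibre `F` over `[c]` factors; here
`ℓ(s) = s₀ c₁ - s₁ c₀` is the equation of `F`.  The first projection is the blow-up of `Σ_r` at the
point `F ∩ E_r = {ℓ = t₁ = 0}`, and the second projection is the contraction of the strict
transform of `F` (given by `ℓ = u₀ = 0`) to a point of `Σ_{r+1}`. -/
def elementaryTransform (r : ℕ) (c : NonzeroPair) : Set (Hirzebruch r × Hirzebruch (r + 1)) :=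
  {P | ∃ s t u : NonzeroPair, P.1 = mk r s t ∧ P.2 = mk (r + 1) s u ∧
    u.1 0 * t.1 1 = (s.1 0 * c.1 1 - s.1 1 * c.1 0) * t.1 0 * u.1 1}

/-- The transform in `Σ_{r+1}` of a curve `C ⊆ Σ_r` that does not pass through the point `F ∩ E_r`
(`F` the fibre over `[c]`): the image under the contraction `Σ_r' → Σ_{r+1}` of the strict transform
of `C` in the blow-up `Σ_r'`.  As the centre is not on `C`, the strict transform is the preimage. -/
def elementaryTransformCurve {r : ℕ} (c : NonzeroPair) (C : Set (Hirzebruch r)) :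
    Set (Hirzebruch (r + 1)) :=
  Prod.snd '' (elementaryTransform r c ∩ Prod.fst ⁻¹' C)

end Hirzebruch

/-- The plane curve `F = 0` in `ℙ²`, for a homogeneous polynomial `F`. -/
def planeCurve (F : MvPolynomial (Fin 3) ℂ) : Set (Projectivization ℂ (Fin 3 → ℂ)) :=
  {P | MvPolynomial.eval P.rep F = 0}

/-- `F = 0` is a smooth plane curve of degree `n`. -/
def IsSmoothPlaneCurve (n : ℕ) (F : MvPolynomial (Fin 3) ℂ) : Prop :=
  F ≠ 0 ∧ F.IsHomogeneous n ∧ ∀ v : Fin 3 → ℂ, v ≠ 0 → MvPolynomial.eval v F = 0 →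
    ∃ k, MvPolynomial.eval v (MvPolynomial.pderiv k F) ≠ 0

/-- The point `a = [0 : 0 : 1]` of the plane. -/
noncomputable def blowUpCentre : Projectivization ℂ (Fin 3 → ℂ) :=
  Projectivization.mk ℂ ![0, 0, 1] (fun h => by simpa using congrFun h 2)

/-!
The plane curve is the Fermat curve `X₀ ^ n + X₁ ^ n + X₂ ^ n = 0`, which is smooth and misses
`a = [0 : 0 : 1]`, and the elementary transform is performed at the fibre `F₀ = {s₀ = 0}`.
The map `Σ_1 ⇢ Σ_2` is then `[s; t₀, t₁] ↦ [s; s₀ t₀, t₁]`, so that the transformed curve has the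
equation `u₀ ^ n + (s₀ ^ n + s₁ ^ n) s₀ ^ n u₁ ^ n = 0`
(`Hirzebruch.mk_mem_fermatTransform_iff`).  Geometrically, the `n` distinct points in which the
Fermat curve meets `F₀` are all sent to the point to which `F₀` is contracted, and the `n` branches
there have distinct tangents.

The curve does not meet `E_2`, so it is covered by the charts with `u₁ = 1`, where its equation is
`x ^ n + (z ^ n + 1) z ^ m = 0` with `m = 0` off the fibre `s₀ = 0` and `m = n` around it.

* Irreducibility: both equations are irreducible by Eisenstein's criterion at a root of `z ^ n + 1`
  (`Hirzebruch.irreducible_chartPoly`), so by the Nullstellensatz each chart of the curve is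
  irreducible, and the two charts overlap in a dense open subset of each.
* Singular points: the partial derivatives vanish together with the equation only at `z = x = 0` in
  the chart with `m = n`.  Conversely, the irreducible equation divides every polynomial vanishing
  on the curve, so all of these have zero differential there.
* Analytic type: near `z = 0` the factor `z ^ n + 1` has a holomorphic `n`-th root `g`, and
  `(z, x) ↦ (z g(z), x)` is a local biholomorphism taking the curve to `x ^ n + y ^ n = 0`
  (`exists_openPartialHomeomorph_fermat`).
-/

/-! ### Irreducible plane curves -/

theorem MvPolynomial.eval_pderiv_eq_zero_of_mem_ker_sq {σ R : Type*} [CommRing R] (a : σ → R)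
    (k : σ) {p : MvPolynomial σ R} (hp : p ∈ RingHom.ker (MvPolynomial.eval a) ^ 2) :
    MvPolynomial.eval a (MvPolynomial.pderiv k p) = 0 := by
  rw [pow_two] at hp
  refine Submodule.mul_induction_on hp (fun f hf g hg => ?_) (fun f g hf hg => ?_)
  · rw [RingHom.mem_ker] at hf hg
    simp [Derivation.leibniz, hf, hg]
  · simp [hf, hg]

/-- Eisenstein's criterion: `x ^ n + h(z)` is irreducible as soon as `h` has a simple root. The
polynomial `h` is taken in one variable indexed by `Fin 1`, to match the coefficient ring of
`MvPolynomial.finSuccEquiv`. -/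
theorem MvPolynomial.irreducible_X_pow_add_rename {n : ℕ} (hn : n ≠ 0)
    (h : MvPolynomial (Fin 1) ℂ) (a : Fin 1 → ℂ) (h0 : MvPolynomial.eval a h = 0)
    (h1 : MvPolynomial.eval a (MvPolynomial.pderiv 0 h) ≠ 0) :
    Irreducible (MvPolynomial.X 1 ^ n + MvPolynomial.rename (fun _ => 0) h :
      MvPolynomial (Fin 2) ℂ) := by
  set e := (MvPolynomial.renameEquiv ℂ (Equiv.swap (0 : Fin 2) 1)).trans
    (MvPolynomial.finSuccEquiv ℂ 1) with he
  -- `e` reads a polynomial in `z, x` as a polynomial in `x` with coefficients in `ℂ[z]`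
  rw [← MulEquiv.irreducible_iff e]
  have hren : (MvPolynomial.finSuccEquiv ℂ 1).toAlgHom.comp
      (MvPolynomial.rename (fun _ => (1 : Fin 2))) =
      (IsScalarTower.toAlgHom ℂ (MvPolynomial (Fin 1) ℂ)
        (Polynomial (MvPolynomial (Fin 1) ℂ))) := by
    ext i : 1
    have : (1 : Fin 2) = Fin.succ i := by fin_cases i; rfl
    simp [this, MvPolynomial.finSuccEquiv_X_succ, -Fin.succ_zero_eq_one, -Fin.succ_one_eq_two]
  have hE : e (MvPolynomial.X 1 ^ n + MvPolynomial.rename (fun _ => 0) h) =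
      Polynomial.X ^ n + Polynomial.C h := by
    have := congrArg (fun φ => φ h) hren
    simp only [AlgHom.comp_apply] at this
    simp only [he, AlgEquiv.trans_apply, map_add, map_pow, MvPolynomial.renameEquiv_apply,
      MvPolynomial.rename_X, MvPolynomial.rename_rename, Equiv.swap_apply_right,
      MvPolynomial.finSuccEquiv_X_zero]
    congr 1
  rw [hE]
  have hmonic : (Polynomial.X ^ n + Polynomial.C h).Monic := Polynomial.monic_X_pow_add_C h hn
  have hdeg : (Polynomial.X ^ n + Polynomial.C h).natDegree = n := Polynomial.natDegree_X_pow_add_C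
  have hP : (RingHom.ker (MvPolynomial.eval a)).IsPrime := RingHom.ker_isPrime _
  refine Polynomial.IsEisensteinAt.irreducible (𝓟 := RingHom.ker (MvPolynomial.eval a))
    ⟨?_, ?_, ?_⟩ hP hmonic.isPrimitive (by omega)
  · rw [hmonic.leadingCoeff]; exact fun hmem => hP.ne_top ((Ideal.eq_top_iff_one _).2 hmem)
  · intro k hk
    rw [hdeg] at hk
    rw [Polynomial.coeff_add, Polynomial.coeff_X_pow, if_neg hk.ne, zero_add,
      Polynomial.coeff_C]
    split_ifs
    · exact h0
    · exact Ideal.zero_mem _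
  · have : (Polynomial.X ^ n + Polynomial.C h).coeff 0 = h := by
      simp [Polynomial.coeff_X_pow, hn.symm]
    rw [this]
    exact fun hmem => h1 (MvPolynomial.eval_pderiv_eq_zero_of_mem_ker_sq a 0 hmem)

/-- A polynomial vanishing on the zero set of an irreducible one is divisible by it. -/
theorem MvPolynomial.dvd_of_irreducible_of_eval_eq_zero {σ : Type*} [Finite σ]
    {p f : MvPolynomial σ ℂ} (hp : Irreducible p)
    (hf : ∀ w, MvPolynomial.eval w p = 0 → MvPolynomial.eval w f = 0) : p ∣ f := by
  have : (Ideal.span {p}).IsPrime :=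
    (Ideal.span_singleton_prime hp.ne_zero).2 hp.prime
  rw [← Ideal.mem_span_singleton,
    ← MvPolynomial.IsPrime.vanishingIdeal_zeroLocus (K := ℂ) (Ideal.span {p})]
  intro w hw
  exact hf w (hw p (Ideal.mem_span_singleton_self p))

theorem MvPolynomial.exists_eval_eq_zero_of_irreducible {σ : Type*} [Finite σ]
    {p : MvPolynomial σ ℂ} (hp : Irreducible p) : ∃ w, MvPolynomial.eval w p = 0 := by
  by_contra! h
  exact hp.not_isUnit (isUnit_of_dvd_one
    (MvPolynomial.dvd_of_irreducible_of_eval_eq_zero hp fun w hw => absurd hw (h w)))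

namespace Hirzebruch

/-- The open sets of `planeZariski` are the unions of non-vanishing loci of polynomials. -/
theorem isOpen_planeZariski_iff {U : Set (Fin 2 → ℂ)} :
    @IsOpen _ planeZariski U ↔ ∃ S : Set (MvPolynomial (Fin 2) ℂ),
      ∀ w, w ∈ U ↔ ∃ f ∈ S, MvPolynomial.eval w f ≠ 0 := by
  rw [isOpen_induced_iff]
  have key : ∀ (w : Fin 2 → ℂ) (S : Set (MvPolynomial (Fin 2) ℂ)),
      (MvPolynomial.pointToPoint w : PrimeSpectrum (MvPolynomial (Fin 2) ℂ)) ∈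
        (PrimeSpectrum.zeroLocus S)ᶜ ↔ ∃ f ∈ S, MvPolynomial.eval w f ≠ 0 := by
    intro w S
    rw [Set.mem_compl_iff, PrimeSpectrum.mem_zeroLocus, Set.not_subset]
    refine exists_congr fun f => and_congr_right fun _ => not_congr ?_
    exact MvPolynomial.mem_vanishingIdeal_singleton_iff w f
  constructor
  · rintro ⟨t, ht, rfl⟩
    obtain ⟨S, hS⟩ := (PrimeSpectrum.isOpen_iff t).1 ht
    refine ⟨S, fun w => ?_⟩
    rw [← key, ← hS, compl_compl]; rfl
  · rintro ⟨S, hS⟩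
    refine ⟨(PrimeSpectrum.zeroLocus S)ᶜ, (PrimeSpectrum.isClosed_zeroLocus S).isOpen_compl, ?_⟩
    ext w
    exact (key w S).trans (hS w).symm

theorem isIrreducible_zeros {p : MvPolynomial (Fin 2) ℂ} (hp : Irreducible p) :
    @IsIrreducible _ planeZariski {w | MvPolynomial.eval w p = 0} := by
  let := planeZariski
  refine ⟨MvPolynomial.exists_eval_eq_zero_of_irreducible hp, ?_⟩
  rintro U V hU hV ⟨u, hu, huU⟩ ⟨v, hv, hvV⟩
  obtain ⟨S, hS⟩ := isOpen_planeZariski_iff.1 hU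
  obtain ⟨T, hT⟩ := isOpen_planeZariski_iff.1 hV
  obtain ⟨f, hfS, hf⟩ := (hS u).1 huU
  obtain ⟨g, hgT, hg⟩ := (hT v).1 hvV
  by_contra hempty
  have hdvd : p ∣ f * g := MvPolynomial.dvd_of_irreducible_of_eval_eq_zero hp fun w hw => by
    by_contra hne
    rw [map_mul] at hne
    exact hempty ⟨w, hw, (hS w).2 ⟨f, hfS, left_ne_zero_of_mul hne⟩,
      (hT w).2 ⟨g, hgT, right_ne_zero_of_mul hne⟩⟩
  rcases hp.prime.dvd_or_dvd hdvd with ⟨k, rfl⟩ | ⟨k, rfl⟩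
  · exact hf (by rw [map_mul, (hu : MvPolynomial.eval u p = 0), zero_mul])
  · exact hg (by rw [map_mul, (hv : MvPolynomial.eval v p = 0), zero_mul])

theorem continuous_chart (r : ℕ) (i j : Fin 2) :
    @Continuous _ _ planeZariski (zariski r) (chart r i j) :=
  continuous_iff_coinduced_le.2
    (le_iSup_of_le i (le_iSup (fun j => TopologicalSpace.coinduced (chart r i j) planeZariski) j))

end Hirzebruch

/-! ### The analytic type of a perturbed Fermat singularity -/

/-- The inverse function theorem in one complex variable, on an open set where both the function and
its inverse are holomorphic. -/
theorem exists_openPartialHomeomorph_of_deriv_ne_zero {f : ℂ → ℂ} {s : Set ℂ} {a : ℂ}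
    (hf : DifferentiableOn ℂ f s) (hs : IsOpen s) (ha : a ∈ s) (hfa : deriv f a ≠ 0) :
    ∃ e : OpenPartialHomeomorph ℂ ℂ, a ∈ e.source ∧ e.source ⊆ s ∧ (e : ℂ → ℂ) = f ∧
      DifferentiableOn ℂ e.symm e.target := by
  have hc : ContDiffAt ℂ 1 f a := (hf.contDiffOn hs).contDiffAt (hs.mem_nhds ha)
  have hd := ((hf a ha).differentiableAt (hs.mem_nhds ha)).hasDerivAt
  let e₀ := hc.toOpenPartialHomeomorph f
    (f' := ContinuousLinearEquiv.unitsEquivAut ℂ (Units.mk0 _ hfa)) (hd.hasFDerivAt_equiv hfa)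
    one_ne_zero
  have he₀ : (e₀ : ℂ → ℂ) = f := rfl
  have ha₀ : a ∈ e₀.source := hc.mem_toOpenPartialHomeomorph_source _ one_ne_zero
  have hs' : IsOpen (s ∩ deriv f ⁻¹' {0}ᶜ) :=
    (hf.deriv hs).continuousOn.isOpen_inter_preimage hs isOpen_compl_singleton
  refine ⟨e₀.restrOpen _ hs', ⟨ha₀, ha, hfa⟩, fun z hz => hz.2.1, rfl, fun w hw => ?_⟩
  obtain ⟨-, hz₁, hz₂⟩ := (e₀.restrOpen _ hs').map_target hw
  exact ((e₀.restrOpen _ hs').hasDerivAt_symm hw hz₂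
    ((hf _ hz₁).differentiableAt
      (hs.mem_nhds hz₁)).hasDerivAt).differentiableAt.differentiableWithinAt

/-- Near the origin, `z ^ n * (z ^ n + 1)` is the `n`-th power of a local coordinate. -/
theorem exists_openPartialHomeomorph_pow_eq {n : ℕ} (hn : n ≠ 0) :
    ∃ e : OpenPartialHomeomorph ℂ ℂ, 0 ∈ e.source ∧ e 0 = 0 ∧
      DifferentiableOn ℂ e e.source ∧ DifferentiableOn ℂ e.symm e.target ∧
      ∀ z ∈ e.source, e z ^ n = (z ^ n + 1) * z ^ n := by
  -- the coordinate is `z` times the principal branch of the `n`-th root of `z ^ n + 1`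
  let g : ℂ → ℂ := fun z => Complex.exp (Complex.log (z ^ n + 1) / n)
  let s : Set ℂ := (fun z : ℂ => z ^ n + 1) ⁻¹' Complex.slitPlane
  have hs : IsOpen s := Complex.isOpen_slitPlane.preimage (by fun_prop)
  have h0 : (0 : ℂ) ∈ s := by simp [s, hn]
  have hg : DifferentiableOn ℂ g s := fun z hz =>
    (((((differentiable_pow n) z).add_const 1).clog hz).div_const _).cexp.differentiableWithinAt
  have hf : DifferentiableOn ℂ (fun z => z * g z) s := differentiableOn_id.mul hg
  have hg0 : g 0 = 1 := by simp [g, hn]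
  have hd : deriv (fun z => z * g z) 0 ≠ 0 := by
    have := (hasDerivAt_id (0 : ℂ)).mul ((hg 0 h0).differentiableAt (hs.mem_nhds h0)).hasDerivAt
    have h2 : deriv (fun z => z * g z) 0 = _ := this.deriv
    rw [h2]
    simp [hg0]
  obtain ⟨e, he0, hes, he, hsymm⟩ := exists_openPartialHomeomorph_of_deriv_ne_zero hf hs h0 hd
  refine ⟨e, he0, by simp [he], he ▸ hf.mono hes, hsymm, fun z hz => ?_⟩
  have hz0 : z ^ n + 1 ≠ 0 := Complex.slitPlane_ne_zero (hes hz)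
  have hgn : g z ^ n = z ^ n + 1 := by
    rw [← Complex.exp_nat_mul, mul_div_cancel₀ _ (Nat.cast_ne_zero.2 hn), Complex.exp_log hz0]
  rw [he, mul_pow, hgn, mul_comm]

/-- A local biholomorphism at the origin taking the curve `x ^ n + (z ^ n + 1) z ^ n = 0` to the
cone `x ^ n + y ^ n = 0`. -/
theorem exists_openPartialHomeomorph_fermat {n : ℕ} (hn : n ≠ 0) :
    ∃ e : OpenPartialHomeomorph (Fin 2 → ℂ) (Fin 2 → ℂ), 0 ∈ e.source ∧ e 0 = 0 ∧
      DifferentiableOn ℂ e e.source ∧ DifferentiableOn ℂ e.symm e.target ∧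
      ∀ w ∈ e.source, e w 0 ^ n + e w 1 ^ n = w 1 ^ n + (w 0 ^ n + 1) * w 0 ^ n := by
  obtain ⟨e, he0, hee, hd, hd', hpow⟩ := exists_openPartialHomeomorph_pow_eq hn
  let e₂ : Fin 2 → OpenPartialHomeomorph ℂ ℂ := ![e, OpenPartialHomeomorph.refl ℂ]
  have key : ∀ (φ : Fin 2 → ℂ → ℂ) (t : Fin 2 → Set ℂ),
      (∀ i, DifferentiableOn ℂ (φ i) (t i)) →
      DifferentiableOn ℂ (fun w i => φ i (w i)) (Set.univ.pi t) := fun φ t h =>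
    differentiableOn_pi.2 fun i => (h i).comp (differentiable_apply i).differentiableOn
      fun w hw => hw i trivial
  refine ⟨OpenPartialHomeomorph.pi e₂, ?_, ?_, key _ _ ?_, key _ _ ?_, ?_⟩
  · intro i _
    fin_cases i
    · exact he0
    · trivial
  · ext i
    fin_cases i
    · exact hee
    · rfl
  · intro i
    fin_cases i
    · exact hd
    · exact differentiableOn_id
  · intro i
    fin_cases i
    · exact hd'
    · exact differentiableOn_id
  · intro w hw
    have h1 : OpenPartialHomeomorph.pi e₂ w 0 = e (w 0) := rfl
    have h2 : OpenPartialHomeomorph.pi e₂ w 1 = w 1 := rfl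
    rw [h1, h2, hpow _ (hw 0 trivial), add_comm]

/-! ### The transform of the Fermat curve -/

/-- The Fermat polynomial `X₀ ^ n + X₁ ^ n + X₂ ^ n`. -/
noncomputable def fermatPoly (n : ℕ) : MvPolynomial (Fin 3) ℂ :=
  MvPolynomial.X 0 ^ n + MvPolynomial.X 1 ^ n + MvPolynomial.X 2 ^ n

theorem eval_fermatPoly (n : ℕ) (v : Fin 3 → ℂ) :
    MvPolynomial.eval v (fermatPoly n) = v 0 ^ n + v 1 ^ n + v 2 ^ n := by
  simp [fermatPoly]

theorem isSmoothPlaneCurve_fermatPoly {n : ℕ} (hn : 2 ≤ n) :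
    IsSmoothPlaneCurve n (fermatPoly n) := by
  refine ⟨fun h => ?_, ?_, fun v hv _ => ?_⟩
  · have := eval_fermatPoly n ![0, 0, 1]
    rw [h] at this
    simp [show n ≠ 0 by omega] at this
  · exact (((MvPolynomial.isHomogeneous_X_pow 0 n).add
      (MvPolynomial.isHomogeneous_X_pow 1 n)).add (MvPolynomial.isHomogeneous_X_pow 2 n))
  · obtain ⟨k, hk⟩ := Function.ne_iff.1 hv
    refine ⟨k, ?_⟩
    have hk' : v k ≠ 0 := hk
    have hn0 : (n : ℂ) ≠ 0 := Nat.cast_ne_zero.2 (by omega)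
    fin_cases k <;>
      simp [fermatPoly, Derivation.leibniz_pow, MvPolynomial.pderiv_X, hn0] <;>
      exact fun h => absurd h hk'

theorem mk_mem_planeCurve_fermatPoly_iff (n : ℕ) {v : Fin 3 → ℂ} (hv : v ≠ 0) :
    Projectivization.mk ℂ v hv ∈ planeCurve (fermatPoly n) ↔ v 0 ^ n + v 1 ^ n + v 2 ^ n = 0 := by
  obtain ⟨a, ha⟩ := Projectivization.exists_smul_eq_mk_rep ℂ v hv
  change MvPolynomial.eval (Projectivization.mk ℂ v hv).rep (fermatPoly n) = 0 ↔ _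
  rw [← ha, eval_fermatPoly]
  simp only [Pi.smul_apply, Units.smul_def, smul_eq_mul, mul_pow, ← mul_add]
  simp

theorem blowUpCentre_notMem_planeCurve_fermatPoly {n : ℕ} (hn : n ≠ 0) :
    blowUpCentre ∉ planeCurve (fermatPoly n) := by
  rw [blowUpCentre, mk_mem_planeCurve_fermatPoly_iff]
  simp [hn]

namespace Hirzebruch

theorem mk_eq_mk_iff {r : ℕ} {s t s' t' : NonzeroPair} :
    mk r s t = mk r s' t' ↔ ∃ l m : ℂ, l ≠ 0 ∧ m ≠ 0 ∧ (∀ k, s'.1 k = l * s.1 k) ∧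
      t'.1 0 = m * l ^ r * t.1 0 ∧ t'.1 1 = m * t.1 1 :=
  Quotient.eq (r := hirzebruchSetoid r)

/-- The fibre of `Σ_1` at which the elementary transform is performed: it lies over `[0 : 1]`, so
that its equation is `s₀ = 0`. -/
noncomputable def baseFibre : NonzeroPair := affinePair 1 0

/-- The transform in `Σ_2` of the Fermat curve of degree `n`. -/
def fermatTransform (n : ℕ) : Set (Hirzebruch 2) :=
  elementaryTransformCurve baseFibre (blowDown ⁻¹' planeCurve (fermatPoly n))

/-- The equation of `fermatTransform n` in homogeneous coordinates. -/
theorem mk_mem_fermatTransform_iff {n : ℕ} (hn : 2 ≤ n) (s u : NonzeroPair) :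
    mk 2 s u ∈ fermatTransform n ↔
      u.1 0 ^ n + (s.1 0 ^ n + s.1 1 ^ n) * s.1 0 ^ n * u.1 1 ^ n = 0 := by
  have hn0 : n ≠ 0 := by omega
  have hblow : ∀ s t : NonzeroPair, blowDown (mk 1 s t) ∈ planeCurve (fermatPoly n) ↔
      (s.1 0 ^ n + s.1 1 ^ n) * t.1 1 ^ n + t.1 0 ^ n = 0 := by
    intro s t
    refine (mk_mem_planeCurve_fermatPoly_iff n _).trans ?_
    simp [mul_pow, add_mul]
  have hbase : ∀ s : NonzeroPair,
      s.1 0 * baseFibre.1 1 - s.1 1 * baseFibre.1 0 = s.1 0 := by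
    intro s; simp [baseFibre, affinePair]
  constructor
  · rintro ⟨⟨P, Q⟩, ⟨⟨s', t, u', hP, hQ, h⟩, hF⟩, hmk⟩
    simp only at hP hQ hmk
    subst hP hQ
    rw [Set.mem_preimage, Set.mem_preimage, hblow] at hF
    rw [hbase] at h
    obtain ⟨l, m, hl, hm, h1, h2, h3⟩ := mk_eq_mk_iff.1 hmk
    have ht : t.1 1 ≠ 0 := by
      intro h0
      have h00 : t.1 0 = 0 := by simpa [h0, hn0] using hF
      exact t.2 (by ext k; fin_cases k <;> simp [h0, h00])
    have hu : u'.1 0 ^ n + (s'.1 0 ^ n + s'.1 1 ^ n) * s'.1 0 ^ n * u'.1 1 ^ n = 0 := by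
      refine (mul_eq_zero.1 (?_ : t.1 1 ^ n * _ = 0)).resolve_left (pow_ne_zero n ht)
      have hpow : u'.1 0 ^ n * t.1 1 ^ n = s'.1 0 ^ n * t.1 0 ^ n * u'.1 1 ^ n := by
        rw [← mul_pow, h, mul_pow, mul_pow]
      linear_combination hpow + s'.1 0 ^ n * u'.1 1 ^ n * hF
    rw [h2, h3, h1, h1]
    simp only [mul_pow]
    linear_combination m ^ n * (l ^ 2) ^ n * hu
  · intro h
    have hlift : ∀ t : NonzeroPair, u.1 0 * t.1 1 = s.1 0 * t.1 0 * u.1 1 →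
        (s.1 0 ^ n + s.1 1 ^ n) * t.1 1 ^ n + t.1 0 ^ n = 0 → mk 2 s u ∈ fermatTransform n :=
      fun t h1 h2 => ⟨(mk 1 s t, mk 2 s u),
        ⟨⟨s, t, u, rfl, rfl, by rw [hbase]; exact h1⟩, (hblow s t).2 h2⟩, rfl⟩
    by_cases h0 : (![u.1 0, s.1 0 * u.1 1] : Fin 2 → ℂ) = 0
    · -- the strict transform of the fibre is contracted to this point: any point of the fibre that
      -- lies on the curve will do
      have hu0 : u.1 0 = 0 := by simpa using congrFun h0 0
      have hsu : s.1 0 * u.1 1 = 0 := by simpa using congrFun h0 1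
      obtain ⟨z, hz⟩ := IsAlgClosed.exists_pow_nat_eq (-(s.1 0 ^ n + s.1 1 ^ n))
        (Nat.pos_of_ne_zero hn0)
      refine hlift (affinePair 1 z) ?_ ?_
      · have hz0 : (affinePair 1 z).1 0 = z := rfl
        rw [hu0, hz0]
        linear_combination -z * hsu
      · simp [affinePair, hz]
    · refine hlift ⟨_, h0⟩ ?_ ?_
      · simp only [Matrix.cons_val_zero, Matrix.cons_val_one]; ring
      · simp only [Matrix.cons_val_zero, Matrix.cons_val_one, mul_pow]
        linear_combination h

/-- The polynomial `x ^ n + (z ^ n + 1) z ^ m`; for `m = 0` and `m = n` it is the equation of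
`fermatTransform n` in the charts `(0, 1)` and `(1, 1)`. -/
noncomputable def chartPoly (n m : ℕ) : MvPolynomial (Fin 2) ℂ :=
  MvPolynomial.X 1 ^ n + (MvPolynomial.X 0 ^ n + 1) * MvPolynomial.X 0 ^ m

theorem eval_chartPoly (n m : ℕ) (w : Fin 2 → ℂ) :
    MvPolynomial.eval w (chartPoly n m) = w 1 ^ n + (w 0 ^ n + 1) * w 0 ^ m := by
  simp [chartPoly]

/-- Eisenstein's criterion applies at any `ζ` with `ζ ^ n = -1`, a simple root of
`(z ^ n + 1) z ^ m`. -/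
theorem irreducible_chartPoly {n : ℕ} (hn : n ≠ 0) (m : ℕ) : Irreducible (chartPoly n m) := by
  obtain ⟨ζ, hζ⟩ := IsAlgClosed.exists_pow_nat_eq (-1 : ℂ) (Nat.pos_of_ne_zero hn)
  have hζ0 : ζ ≠ 0 := by rintro rfl; simp [hn] at hζ
  have := MvPolynomial.irreducible_X_pow_add_rename hn
    ((MvPolynomial.X 0 ^ n + 1) * MvPolynomial.X 0 ^ m) (fun _ => ζ) (by simp [hζ])
    (by simp [Derivation.leibniz, Derivation.leibniz_pow, hζ, hζ0, hn])
  simpa [chartPoly] using this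

theorem chart_zero_one_mem_fermatTransform_iff {n : ℕ} (hn : 2 ≤ n) (w : Fin 2 → ℂ) :
    chart 2 0 1 w ∈ fermatTransform n ↔ MvPolynomial.eval w (chartPoly n 0) = 0 := by
  rw [chart, mk_mem_fermatTransform_iff hn, eval_chartPoly]
  simp [affinePair, add_comm (1 : ℂ)]

theorem chart_one_one_mem_fermatTransform_iff {n : ℕ} (hn : 2 ≤ n) (w : Fin 2 → ℂ) :
    chart 2 1 1 w ∈ fermatTransform n ↔ MvPolynomial.eval w (chartPoly n n) = 0 := by
  rw [chart, mk_mem_fermatTransform_iff hn, eval_chartPoly]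
  simp [affinePair]

theorem isCurve_fermatTransform {n : ℕ} (hn : 2 ≤ n) : IsCurve (fermatTransform n) := by
  have hn0 : n ≠ 0 := by omega
  -- the equation in the charts `(i, 0)`, which meet the section `E_2`
  have h0 : ∀ m, (1 + (MvPolynomial.X 0 ^ n + 1) * MvPolynomial.X 0 ^ m * MvPolynomial.X 1 ^ n :
      MvPolynomial (Fin 2) ℂ) ≠ 0 := fun m h => by
    simpa [hn0] using congrArg (MvPolynomial.eval 0) h
  intro i j
  fin_cases i <;> fin_cases j
  · refine ⟨_, h0 0, fun w => ?_⟩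
    change mk _ _ _ ∈ _ ↔ _
    rw [mk_mem_fermatTransform_iff hn]
    simp [affinePair, add_comm]
  · exact ⟨_, (irreducible_chartPoly hn0 0).ne_zero, chart_zero_one_mem_fermatTransform_iff hn⟩
  · refine ⟨_, h0 n, fun w => ?_⟩
    change mk _ _ _ ∈ _ ↔ _
    rw [mk_mem_fermatTransform_iff hn]
    simp [affinePair]
  · exact ⟨_, (irreducible_chartPoly hn0 n).ne_zero, chart_one_one_mem_fermatTransform_iff hn⟩

theorem mk_eq_chart_zero_one {r : ℕ} {s u : NonzeroPair} (hs : s.1 0 ≠ 0) (hu : u.1 1 ≠ 0) :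
    mk r s u = chart r 0 1 ![s.1 1 / s.1 0, u.1 0 / (s.1 0 ^ r * u.1 1)] := by
  refine mk_eq_mk_iff.2 ⟨(s.1 0)⁻¹, (u.1 1)⁻¹, inv_ne_zero hs, inv_ne_zero hu, fun k => ?_, ?_, ?_⟩
  · fin_cases k
    · simp [affinePair, hs]
    · simp [affinePair]; field_simp
  · simp [affinePair]; field_simp
  · simp [affinePair, hu]

theorem mk_eq_chart_one_one {r : ℕ} {s u : NonzeroPair} (hs : s.1 1 ≠ 0) (hu : u.1 1 ≠ 0) :
    mk r s u = chart r 1 1 ![s.1 0 / s.1 1, u.1 0 / (s.1 1 ^ r * u.1 1)] := by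
  refine mk_eq_mk_iff.2 ⟨(s.1 1)⁻¹, (u.1 1)⁻¹, inv_ne_zero hs, inv_ne_zero hu, fun k => ?_, ?_, ?_⟩
  · fin_cases k
    · simp [affinePair]; field_simp
    · simp [affinePair, hs]
  · simp [affinePair]; field_simp
  · simp [affinePair, hu]

/-- The transform does not meet the section `E_2`, so two of the four charts cover it. -/
theorem exists_chart_eq_of_mem_fermatTransform {n : ℕ} (hn : 2 ≤ n) {p : Hirzebruch 2}
    (hp : p ∈ fermatTransform n) : (∃ w, chart 2 0 1 w = p) ∨ ∃ w, chart 2 1 1 w = p := by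
  have hn0 : n ≠ 0 := by omega
  obtain ⟨⟨s, u⟩, rfl⟩ := Quotient.exists_rep p
  change mk 2 s u ∈ _ at hp
  rw [mk_mem_fermatTransform_iff hn] at hp
  have hu : u.1 1 ≠ 0 := by
    intro h0
    have h00 : u.1 0 = 0 := by simpa [h0, hn0] using hp
    exact u.2 (by ext k; fin_cases k <;> simp [h0, h00])
  by_cases hs : s.1 0 = 0
  · have hs1 : s.1 1 ≠ 0 := fun h1 => s.2 (by ext k; fin_cases k <;> simp [hs, h1])
    exact Or.inr ⟨_, (mk_eq_chart_one_one hs1 hu).symm⟩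
  · exact Or.inl ⟨_, (mk_eq_chart_zero_one hs hu).symm⟩

theorem isIrreducible_fermatTransform {n : ℕ} (hn : 2 ≤ n) : IsIrreducible (fermatTransform n) := by
  have hn0 : n ≠ 0 := by omega
  let := planeZariski
  set A := chart 2 0 1 '' {w | MvPolynomial.eval w (chartPoly n 0) = 0} with hA
  have hAirr : IsIrreducible A :=
    (isIrreducible_zeros (irreducible_chartPoly hn0 0)).image _ (continuous_chart 2 0 1).continuousOn
  have hAC : A ⊆ fermatTransform n := by
    rintro _ ⟨w, hw, rfl⟩
    exact (chart_zero_one_mem_fermatTransform_iff hn w).2 hw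
  -- an open set that meets the curve on the fibre `s₀ = 0` also meets it off this fibre
  have key : ∀ U : Set (Hirzebruch 2), IsOpen U → (fermatTransform n ∩ U).Nonempty →
      (A ∩ U).Nonempty := by
    rintro U hU ⟨p, hp, hpU⟩
    rcases exists_chart_eq_of_mem_fermatTransform hn hp with ⟨w, rfl⟩ | ⟨w, rfl⟩
    · exact ⟨_, ⟨w, (chart_zero_one_mem_fermatTransform_iff hn w).1 hp, rfl⟩, hpU⟩
    · have hopen : IsOpen {w : Fin 2 → ℂ | w 0 ≠ 0} :=
        isOpen_planeZariski_iff.2 ⟨{MvPolynomial.X 0}, fun w => by simp⟩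
      obtain ⟨ζ, hζ⟩ := IsAlgClosed.exists_pow_nat_eq (-1 : ℂ) (Nat.pos_of_ne_zero hn0)
      have hζ0 : ζ ≠ 0 := by rintro rfl; simp [hn0] at hζ
      obtain ⟨v, hv, hvU, hv0⟩ := (isIrreducible_zeros (irreducible_chartPoly hn0 n)).2 _ _
        (hU.preimage (continuous_chart 2 1 1)) hopen
        ⟨w, (chart_one_one_mem_fermatTransform_iff hn w).1 hp, hpU⟩
        ⟨![ζ, 0], by simp [eval_chartPoly, hζ, hn0], by simpa using hζ0⟩
      have hvC := (chart_one_one_mem_fermatTransform_iff hn v).2 hv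
      have hv' := mk_eq_chart_zero_one (r := 2) (s := affinePair 1 (v 0)) (u := affinePair 1 (v 1))
        (by simpa [affinePair] using hv0) (by simp [affinePair])
      change chart 2 1 1 v = _ at hv'
      refine ⟨_, ⟨_, ?_, hv'.symm⟩, hvU⟩
      rw [hv'] at hvC
      exact (chart_zero_one_mem_fermatTransform_iff hn _).1 hvC
  refine ⟨hAirr.nonempty.mono hAC, fun U V hU hV hCU hCV => ?_⟩
  exact (hAirr.2 U V hU hV (key U hU hCU) (key V hV hCV)).mono
    (Set.inter_subset_inter_left _ hAC)

theorem eval_pderiv_zero_chartPoly (n m : ℕ) (w : Fin 2 → ℂ) :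
    MvPolynomial.eval w (MvPolynomial.pderiv 0 (chartPoly n m)) =
      (w 0 ^ n + 1) * (m * w 0 ^ (m - 1)) + w 0 ^ m * (n * w 0 ^ (n - 1)) := by
  simp [chartPoly, Derivation.leibniz, Derivation.leibniz_pow, MvPolynomial.pderiv_X]

theorem eval_pderiv_one_chartPoly (n m : ℕ) (w : Fin 2 → ℂ) :
    MvPolynomial.eval w (MvPolynomial.pderiv 1 (chartPoly n m)) = n * w 1 ^ (n - 1) := by
  simp [chartPoly, Derivation.leibniz, Derivation.leibniz_pow, MvPolynomial.pderiv_X]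

theorem isSingularPoint_fermatTransform_iff {n : ℕ} (hn : 2 ≤ n) (p : Hirzebruch 2) :
    IsSingularPoint (fermatTransform n) p ↔ p = chart 2 1 1 0 := by
  have hn0 : n ≠ 0 := by omega
  have hn1 : n - 1 ≠ 0 := by omega
  have hnC : (n : ℂ) ≠ 0 := Nat.cast_ne_zero.2 hn0
  constructor
  · rintro ⟨hp, hsing⟩
    rcases exists_chart_eq_of_mem_fermatTransform hn hp with ⟨w, rfl⟩ | ⟨w, rfl⟩
    · have hd := hsing 0 1 w rfl _ fun v => (chart_zero_one_mem_fermatTransform_iff hn v).1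
      have h := (chart_zero_one_mem_fermatTransform_iff hn w).1 hp
      have h0 : w 0 = 0 := by simpa [eval_pderiv_zero_chartPoly, hnC, hn1] using hd 0
      have h1 : w 1 = 0 := by simpa [eval_pderiv_one_chartPoly, hnC, hn1] using hd 1
      simp [eval_chartPoly, h0, h1, hn0] at h
    · have hd := hsing 1 1 w rfl _ fun v => (chart_one_one_mem_fermatTransform_iff hn v).1
      have h := (chart_one_one_mem_fermatTransform_iff hn w).1 hp
      have h1 : w 1 = 0 := by simpa [eval_pderiv_one_chartPoly, hnC, hn1] using hd 1
      have h0 : w 0 = 0 := by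
        by_contra hw
        rw [eval_chartPoly, h1, zero_pow hn0, zero_add] at h
        have hw1 : w 0 ^ n + 1 = 0 := (mul_eq_zero.1 h).resolve_right (pow_ne_zero n hw)
        simpa [eval_pderiv_zero_chartPoly, hw1, hnC, hw] using hd 0
      have : w = 0 := by ext k; fin_cases k <;> simp [h0, h1]
      rw [this]
  · rintro rfl
    have he : MvPolynomial.eval 0 (chartPoly n n) = 0 := by rw [eval_chartPoly]; simp [hn0]
    refine ⟨(chart_one_one_mem_fermatTransform_iff hn 0).2 he, ?_⟩
    intro i j z hz f hf k
    obtain ⟨l, m, hl, hm, h1, h2, h3⟩ := mk_eq_mk_iff.1 hz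
    have hi : i = 1 := by
      by_contra hi
      have hi' : i = 0 := by omega
      subst hi'
      exact hl (by simpa [affinePair] using (h1 0).symm)
    have hj : j = 1 := by
      by_contra hj
      have hj' : j = 0 := by omega
      subst hj'
      simp [affinePair, hl, hm] at h2
    subst hi hj
    have hz0 : z = 0 := by
      ext k
      fin_cases k
      · simpa [affinePair, hl] using h1 0
      · simpa [affinePair, hl, hm] using h2
    subst hz0
    obtain ⟨g, rfl⟩ := MvPolynomial.dvd_of_irreducible_of_eval_eq_zero
      (irreducible_chartPoly hn0 n)
      fun w hw => hf w ((chart_one_one_mem_fermatTransform_iff hn w).2 hw)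
    have hd : MvPolynomial.eval 0 (MvPolynomial.pderiv k (chartPoly n n)) = 0 := by
      fin_cases k
      · exact (eval_pderiv_zero_chartPoly n n 0).trans (by simp [hn0, hn1])
      · exact (eval_pderiv_one_chartPoly n n 0).trans (by simp [hn1])
    rw [Derivation.leibniz]
    simp only [smul_eq_mul, map_add, map_mul, he, hd, zero_mul, mul_zero, add_zero]

theorem hasAnalyticType_fermatTransform {n : ℕ} (hn : 2 ≤ n) :
    HasAnalyticType (fermatTransform n) (chart 2 1 1 0)
      (MvPolynomial.X 0 ^ n + MvPolynomial.X 1 ^ n) := by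
  obtain ⟨e, h0, he0, hd, hd', hpow⟩ := exists_openPartialHomeomorph_fermat (n := n) (by omega)
  refine ⟨1, 1, 0, e, rfl, h0, he0, hd, hd', fun w hw => ?_⟩
  rw [chart_one_one_mem_fermatTransform_iff hn, eval_chartPoly, ← hpow w hw]
  simp

end Hirzebruch

theorem mainTheorem11 (n : ℕ) (hn : 2 ≤ n) :
    ∃ C : Set (Hirzebruch 2),
      -- `C` is an irreducible curve
      Hirzebruch.IsCurve C ∧ IsIrreducible C ∧
      -- with a unique singular point `q`, analytically of type `x ^ n + y ^ n = 0`
      (∃ q : Hirzebruch 2, (∀ p, Hirzebruch.IsSingularPoint C p ↔ p = q) ∧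
        Hirzebruch.HasAnalyticType C q (MvPolynomial.X 0 ^ n + MvPolynomial.X 1 ^ n)) ∧
      -- obtained from a smooth plane curve of degree `n` not through `a`, by blowing up `a` and
      -- performing the elementary transform at some fibre
      (∃ (F : MvPolynomial (Fin 3) ℂ) (c : NonzeroPair),
        IsSmoothPlaneCurve n F ∧ blowUpCentre ∉ planeCurve F ∧
        C = Hirzebruch.elementaryTransformCurve c (Hirzebruch.blowDown ⁻¹' planeCurve F)) :=
  ⟨Hirzebruch.fermatTransform n, Hirzebruch.isCurve_fermatTransform hn,
    Hirzebruch.isIrreducible_fermatTransform hn,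
    ⟨Hirzebruch.chart 2 1 1 0, Hirzebruch.isSingularPoint_fermatTransform_iff hn,
      Hirzebruch.hasAnalyticType_fermatTransform hn⟩,
    fermatPoly n, Hirzebruch.baseFibre, isSmoothPlaneCurve_fermatPoly hn,
    blowUpCentre_notMem_planeCurve_fermatPoly (by omega), rfl⟩
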